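/- Let $A$ and $B$ be finite sets, let $\Delta \ge 0$ be an integer, and let $M \in \{0,1,\dots,\Delta\}^{A\times B}$ be a matrix whose rank over $\mathbb{R}$ is $r$. A rectangle $R$ of $M$ is a submatrix $M[A',B']$ given by subsets $A' \subseteq A$ and $B' \subseteq B$ (possibly empty); we write $(a,b) \in R$ if $a \in A'$ and $b \in B'$. For $\alpha \in [-1,1]$ put \[ h(\alpha) = \frac12\left(1 - \frac{\arccos(\alpha)}{\pi}\right). \] Then for every integer $k \ge 0$ there is a probability distribution $\mathcal{D}_k$ on the rectangles of $M$ such that for all $a \in A$ and $b \in B$, \[ \Pr_{R \sim \mathcal{D}_k}\bigl[(a,b) \in R\bigr] = \left( h\left( \frac{M_{a,b}}{\Delta\sqrt{r}} \right) \right)^{k}. \] If $M = 0$ (the only case in which the denominator $\Delta\sqrt{r}$ can vanish), the quotient $M_{a,b}/(\Delta\sqrt{r})$ is read as $0$. -/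

import Mathlib

/-- A rectangle of a matrix with rows indexed by `A` and columns indexed by `B`: the
(non-contiguous) submatrix given by a set of rows and a set of columns. -/
@[ext]
structure Rectangle (A B : Type*) where
  /-- the set of selected rows -/
  rows : Set A
  /-- the set of selected columns -/
  cols : Set B

/-- The entry `(a, b)` lies in the rectangle when row `a` and column `b` are selected. -/
instance Rectangle.instMembership (A B : Type*) : Membership (A × B) (Rectangle A B) where
  mem R p := p.1 ∈ R.rows ∧ p.2 ∈ R.cols

/-- The function `h(α) = (1 - arccos(α) / π) / 2`. -/
noncomputable def sheppardH (α : ℝ) : ℝ :=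
  (1 / 2) * (1 - Real.arccos α / Real.pi)

/-! If `u a` and `v b` are unit vectors and `x` is a standard Gaussian, the rows with `⟪u a, x⟫ > 0`
and columns with `⟪v b, x⟫ > 0` form a random rectangle. By Sheppard's formula it contains `(a, b)`
with probability `h(⟪u a, v b⟫)`, and intersecting `k` independent copies gives the `k`-th power.

It remains to realize `M / (Δ√r)` by inner products of unit vectors. Factor `M = X * Y` through
dimension `r` and pick row weights `p` maximizing `det G`, where `G = Xᵀ diag(p) X`. Optimality
bounds every leverage `xₐᵀ G⁻¹ xₐ` by `r`. Writing `G = Cᵀ C`, the vectors `C⁻ᵀ xₐ` have squared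
norm at most `r`, while `C y_b` has squared norm `∑ pₐ M_{ab}² ≤ Δ²`. Rescaling and padding with two
coordinates finishes. -/

open Matrix in
lemma Matrix.exists_rank_factorization {A B K : Type*} [Finite A] [Fintype B] [Field K]
    (M : Matrix A B K) :
    ∃ (X : Matrix A (Fin M.rank) K) (Y : Matrix (Fin M.rank) B K),
      M = X * Y ∧ Function.Injective X.mulVec := by
  classical
  let b : Module.Basis (Fin M.rank) K (LinearMap.range M.mulVecLin) := Module.finBasis K _
  have hcol (j : B) : M.col j ∈ LinearMap.range M.mulVecLin :=
    ⟨Pi.single j 1, by simp⟩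
  refine ⟨.of fun a i => (b i : A → K) a, .of fun i j => b.repr ⟨M.col j, hcol j⟩ i, ?_, ?_⟩
  · ext a j
    have h := congrArg (fun w : LinearMap.range M.mulVecLin => (w : A → K) a)
      (b.sum_repr ⟨M.col j, hcol j⟩)
    simp only [AddSubmonoidClass.coe_finsetSum, Submodule.coe_smul, Finset.sum_apply,
      Pi.smul_apply, smul_eq_mul, col_apply] at h
    rw [mul_apply, ← h]
    exact Finset.sum_congr rfl fun i _ => mul_comm _ _
  · rw [mulVec_injective_iff]
    exact b.linearIndependent.map' (Submodule.subtype _) (Submodule.ker_subtype _)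

/-- Both sides equal 1 at `s = 0`, so their slopes there compare. This extracts the first-order
condition from optimality of the weights. -/
lemma le_natCast_of_one_add_mul_le_one_add_pow {q : ℝ} {d : ℕ}
    (h : ∀ s : ℝ, 0 < s → 1 + s * q ≤ (1 + s) ^ d) : q ≤ d := by
  by_contra! hq
  have hd : (0 : ℝ) ≤ d := d.cast_nonneg
  have key (s : ℝ) (hs : 0 < s) : (1 + s * q) * (1 - d * s) ≤ 1 := by
    have hpow : (1 + s) ^ d ≤ Real.exp (d * s) := by
      rw [Real.exp_nat_mul]
      exact pow_le_pow_left₀ (by positivity) (by linarith [Real.add_one_le_exp s]) d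
    have hneg : 1 - d * s ≤ Real.exp (-(d * s)) := by linarith [Real.add_one_le_exp (-(d * s))]
    have hpos : 0 ≤ 1 + s * q := by nlinarith
    calc (1 + s * q) * (1 - d * s) ≤ (1 + s * q) * Real.exp (-(d * s)) := by gcongr
      _ ≤ Real.exp (d * s) * Real.exp (-(d * s)) := by
        gcongr
        exact (h s hs).trans hpow
      _ = 1 := by rw [← Real.exp_add]; simp
  have hqd : 0 ≤ q * d := mul_nonneg (hd.trans hq.le) hd
  -- `key` expands to `q - d ≤ s * q * d`; this `s` makes the right side less than `(q - d) / 2`.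
  set s := (q - d) / (2 * (q * d + 1)) with hs
  have hs0 : 0 < s := div_pos (by linarith) (by linarith)
  have h1 := key s hs0
  have h2 : s * (2 * (q * d + 1)) = q - d := by rw [hs]; field_simp
  have h3 : s * (q - d) ≤ s * (s * (q * d)) := by nlinarith
  have h4 := le_of_mul_le_mul_left h3 hs0
  nlinarith

/-! ### Optimal weights and bounded Gram factorizations -/

namespace Matrix

variable {A ι : Type*} [Fintype A] [DecidableEq A]

/-- The second moment matrix of the rows of `X`, the row `a` having weight `p a`. -/
noncomputable def weightedGram (X : Matrix A ι ℝ) (p : A → ℝ) : Matrix ι ι ℝ :=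
  Xᵀ * diagonal p * X

lemma weightedGram_add_single (X : Matrix A ι ℝ) (p : A → ℝ) (s : ℝ) (a : A) :
    X.weightedGram (p + Pi.single a s) =
      X.weightedGram p + replicateCol Unit (s • X a) * replicateRow Unit (X a) := by
  ext i j
  rw [add_apply, weightedGram, weightedGram, mul_apply, mul_apply, mul_apply]
  simp only [mul_diagonal, transpose_apply, Pi.add_apply, mul_add, add_mul,
    Finset.sum_add_distrib, Pi.single_apply, mul_ite, ite_mul, mul_zero, zero_mul,
    Finset.sum_ite_eq', Finset.mem_univ, if_true, replicateCol_apply, replicateRow_apply,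
    Finset.univ_unique, Finset.sum_singleton, Pi.smul_apply, smul_eq_mul]
  rw [mul_comm s]

lemma weightedGram_smul (X : Matrix A ι ℝ) (p : A → ℝ) (c : ℝ) :
    X.weightedGram (c • p) = c • X.weightedGram p := by
  simp [weightedGram, diagonal_smul]

variable [Fintype ι]

lemma dotProduct_weightedGram_mulVec (X : Matrix A ι ℝ) (p : A → ℝ) (y : ι → ℝ) :
    y ⬝ᵥ X.weightedGram p *ᵥ y = ∑ a, p a * (X *ᵥ y) a ^ 2 := by
  rw [weightedGram, ← mulVec_mulVec, ← mulVec_mulVec, dotProduct_mulVec, vecMul_transpose,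
    dotProduct]
  simp only [mulVec_diagonal]
  exact Finset.sum_congr rfl fun a _ => by ring

lemma posSemidef_weightedGram (X : Matrix A ι ℝ) {p : A → ℝ} (hp : 0 ≤ p) :
    (X.weightedGram p).PosSemidef := by
  simpa [weightedGram, conjTranspose_eq_transpose_of_trivial] using
    (PosSemidef.diagonal hp).conjTranspose_mul_mul_same X

lemma posDef_weightedGram {X : Matrix A ι ℝ} (hX : Function.Injective X.mulVec) {p : A → ℝ}
    (hp : ∀ a, 0 < p a) : (X.weightedGram p).PosDef := by
  simpa [weightedGram, conjTranspose_eq_transpose_of_trivial] using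
    (PosDef.diagonal hp).conjTranspose_mul_mul_same hX

variable [DecidableEq ι]

/-- Extra weight on one row is a rank-one update, so the matrix determinant lemma applies; the
relative slope in `s` is the leverage of that row. -/
lemma det_weightedGram_add_single {X : Matrix A ι ℝ} {p : A → ℝ}
    (hp : IsUnit (X.weightedGram p).det) (s : ℝ) (a : A) :
    (X.weightedGram (p + Pi.single a s)).det =
      (X.weightedGram p).det * (1 + s * (X a ⬝ᵥ (X.weightedGram p)⁻¹ *ᵥ X a)) := by
  rw [weightedGram_add_single, det_add_replicateCol_mul_replicateRow hp,
    det_unique (n := Unit), Matrix.mul_assoc, ← replicateCol_mulVec]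
  simp [mul_apply, dotProduct, mulVec_smul, Finset.mul_sum]

/-- The **Kiefer–Wolfowitz theorem**: if the rows of `X` span, there is a probability vector for
which every row has leverage at most the dimension. -/
theorem exists_weightedGram_leverage_le [Nonempty A] {X : Matrix A ι ℝ}
    (hX : Function.Injective X.mulVec) :
    ∃ p ∈ stdSimplex ℝ A, (X.weightedGram p).PosDef ∧
      ∀ a, X a ⬝ᵥ (X.weightedGram p)⁻¹ *ᵥ X a ≤ Fintype.card ι := by
  have hcont : Continuous fun p : A → ℝ => (X.weightedGram p).det := by
    unfold weightedGram
    fun_prop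
  have hcard : (0 : ℝ) < Fintype.card A := by exact_mod_cast Fintype.card_pos
  have hunif : (fun _ : A => (Fintype.card A : ℝ)⁻¹) ∈ stdSimplex ℝ A :=
    ⟨fun _ => by positivity, by simp⟩
  obtain ⟨p, hp, hmax⟩ := (isCompact_stdSimplex ℝ A).exists_isMaxOn ⟨_, hunif⟩ hcont.continuousOn
  have hdet : 0 < (X.weightedGram p).det :=
    (posDef_weightedGram hX fun _ => inv_pos.2 hcard).det_pos.trans_le (hmax hunif)
  have hunit : IsUnit (X.weightedGram p).det := hdet.ne'.isUnit
  refine ⟨p, hp, (posSemidef_weightedGram X hp.1).posDef_iff_isUnit.2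
    ((isUnit_iff_isUnit_det _).2 hunit), fun a => ?_⟩
  refine le_natCast_of_one_add_mul_le_one_add_pow fun s hs => ?_
  -- Competitor: shift weight towards `a` and renormalize. The renormalization contributes the
  -- factor `(1 + s)⁻¹` to the power of the dimension.
  have hmem : (1 + s)⁻¹ • (p + Pi.single a s) ∈ stdSimplex ℝ A := by
    refine ⟨fun i => ?_, ?_⟩
    · have : 0 ≤ (Pi.single a s : A → ℝ) i := by
        rw [Pi.single_apply]
        split_ifs <;> linarith
      have := hp.1 i
      simp only [Pi.smul_apply, Pi.add_apply, smul_eq_mul]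
      positivity
    · simp only [Pi.smul_apply, Pi.add_apply, smul_eq_mul, ← Finset.mul_sum,
        Finset.sum_add_distrib, hp.2, Finset.sum_pi_single', Finset.mem_univ, if_true]
      exact inv_mul_cancel₀ (by positivity)
  have hle : (X.weightedGram ((1 + s)⁻¹ • (p + Pi.single a s))).det ≤ (X.weightedGram p).det :=
    hmax hmem
  rw [weightedGram_smul, det_smul, det_weightedGram_add_single hunit, inv_pow,
    inv_mul_le_iff₀ (by positivity), mul_comm _ (X.weightedGram p).det] at hle
  exact le_of_mul_le_mul_left hle hdet

open scoped MatrixOrder RealInnerProductSpace in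
/-- A real matrix of rank `r` with entries bounded by `Δ` is a Gram matrix of vectors of norm at most
`√r` and vectors of norm at most `Δ`. -/
theorem exists_inner_eq_of_abs_le {B : Type*} [Fintype B] (M : Matrix A B ℝ) {Δ : ℝ}
    (hM : ∀ a b, |M a b| ≤ Δ) :
    ∃ (u : A → EuclideanSpace ℝ (Fin M.rank)) (v : B → EuclideanSpace ℝ (Fin M.rank)),
      (∀ a b, ⟪u a, v b⟫ = M a b) ∧ (∀ a, ‖u a‖ ^ 2 ≤ M.rank) ∧ ∀ b, ‖v b‖ ^ 2 ≤ Δ ^ 2 := by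
  cases isEmpty_or_nonempty A
  · exact ⟨isEmptyElim, 0, isEmptyElim, isEmptyElim, fun b => by simpa using sq_nonneg Δ⟩
  obtain ⟨X, Y, hXY, hX⟩ := M.exists_rank_factorization
  obtain ⟨p, hp, hpos, hlev⟩ := exists_weightedGram_leverage_le hX
  obtain ⟨C, hC⟩ := CStarAlgebra.nonneg_iff_eq_star_mul_self.1 hpos.posSemidef.nonneg
  rw [star_eq_conjTranspose, conjTranspose_eq_transpose_of_trivial] at hC
  have hCu : IsUnit C.det := by
    have := (isUnit_iff_isUnit_det _).1 hpos.isUnit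
    rw [hC, det_mul] at this
    exact isUnit_of_mul_isUnit_right this
  refine ⟨fun a => WithLp.toLp 2 (X a ᵥ* C⁻¹), fun b => WithLp.toLp 2 (C *ᵥ Y.col b),
    fun a b => ?_, fun a => ?_, fun b => ?_⟩
  · rw [EuclideanSpace.inner_toLp_toLp, star_trivial, dotProduct_comm, dotProduct_mulVec,
      vecMul_vecMul, nonsing_inv_mul _ hCu, vecMul_one]
    exact (congrFun₂ hXY a b).symm
  · rw [← real_inner_self_eq_norm_sq, EuclideanSpace.inner_toLp_toLp, star_trivial]
    refine le_of_eq_of_le ?_ ((hlev a).trans_eq (by simp))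
    rw [hC, Matrix.mul_inv_rev, ← mulVec_mulVec, dotProduct_mulVec, ← transpose_nonsing_inv,
      mulVec_transpose]
  · rw [← real_inner_self_eq_norm_sq, EuclideanSpace.inner_toLp_toLp, star_trivial]
    calc C *ᵥ Y.col b ⬝ᵥ C *ᵥ Y.col b = Y.col b ⬝ᵥ X.weightedGram p *ᵥ Y.col b := by
          rw [hC, ← mulVec_mulVec, dotProduct_mulVec _ Cᵀ, vecMul_transpose]
      _ = ∑ a, p a * M a b ^ 2 := by
          rw [dotProduct_weightedGram_mulVec]
          exact Finset.sum_congr rfl fun a _ => by rw [congrFun₂ hXY a b]; rfl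
      _ ≤ ∑ a, p a * Δ ^ 2 := by
          exact Finset.sum_le_sum fun a _ => mul_le_mul_of_nonneg_left
            (sq_le_sq.2 ((hM a b).trans (le_abs_self Δ))) (hp.1 a)
      _ = Δ ^ 2 := by rw [← Finset.sum_mul, hp.2, one_mul]

end Matrix

/-! ### Gaussian measure of planar cones and Sheppard's formula -/

open MeasureTheory ProbabilityTheory Set
open scoped RealInnerProductSpace ENNReal

/-- In polar coordinates `φ` sees only the radius and `S` only the angle, so the integral factors.
-/
lemma lintegral_mul_indicator_angle (φ : ℝ → ℝ≥0∞) (hφ : Measurable φ) {S : Set (ℝ × ℝ)}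
    (T : Set ℝ) (hT : MeasurableSet T)
    (hST : ∀ r : ℝ, 0 < r → ∀ t ∈ Ioo (-Real.pi) Real.pi,
      ((r * Real.cos t, r * Real.sin t) ∈ S ↔ t ∈ T)) :
    ∫⁻ z : ℝ × ℝ, S.indicator (fun z => φ (z.1 ^ 2 + z.2 ^ 2)) z =
      (∫⁻ r in Ioi (0 : ℝ), ENNReal.ofReal r * φ (r ^ 2)) *
        volume (T ∩ Ioo (-Real.pi) Real.pi) := by
  rw [← lintegral_comp_polarCoord_symm, polarCoord_target, Measure.volume_eq_prod,
    ← Measure.prod_restrict]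
  rw [← Measure.restrict_apply hT, ← lintegral_indicator_one hT, ← lintegral_prod_mul]
  · rw [Measure.prod_restrict]
    refine setLIntegral_congr_fun (measurableSet_Ioi.prod measurableSet_Ioo) fun z hz => ?_
    have hz' := hST z.1 hz.1 z.2 hz.2
    have hsq : (z.1 * Real.cos z.2) ^ 2 + (z.1 * Real.sin z.2) ^ 2 = z.1 ^ 2 := by
      linear_combination z.1 ^ 2 * Real.cos_sq_add_sin_sq z.2
    by_cases h : z.2 ∈ T <;> simp [polarCoord_symm_apply, indicator, hz', h, hsq]
  · fun_prop
  · exact (measurable_one.indicator hT).aemeasurable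

lemma gaussianReal_prod_apply_eq_lintegral (S : Set (ℝ × ℝ)) (hS : MeasurableSet S) :
    ((gaussianReal 0 1).prod (gaussianReal 0 1)) S =
      ∫⁻ z : ℝ × ℝ, S.indicator
        (fun z => ENNReal.ofReal ((2 * Real.pi)⁻¹ * Real.exp (-(z.1 ^ 2 + z.2 ^ 2) / 2))) z := by
  rw [gaussianReal_of_var_ne_zero _ one_ne_zero,
    prod_withDensity (measurable_gaussianPDF _ _) (measurable_gaussianPDF _ _),
    withDensity_apply _ hS, lintegral_indicator hS, Measure.volume_eq_prod]
  refine setLIntegral_congr_fun hS fun z _ => ?_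
  simp only [gaussianPDF]
  rw [← ENNReal.ofReal_mul (gaussianPDFReal_nonneg _ _ _)]
  congr 1
  have h2 : √(2 * Real.pi) * √(2 * Real.pi) = 2 * Real.pi := Real.mul_self_sqrt (by positivity)
  simp only [gaussianPDFReal, NNReal.coe_one, mul_one, sub_zero]
  rw [mul_mul_mul_comm, ← mul_inv, h2, ← Real.exp_add]
  congr 2
  ring

/-- The standard Gaussian measure of a planar cone is proportional to its angle. -/
lemma gaussianReal_prod_cone {S : Set (ℝ × ℝ)} (hS : MeasurableSet S)
    (T : Set ℝ) (hT : MeasurableSet T)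
    (hST : ∀ r : ℝ, 0 < r → ∀ t ∈ Ioo (-Real.pi) Real.pi,
      ((r * Real.cos t, r * Real.sin t) ∈ S ↔ t ∈ T)) :
    ((gaussianReal 0 1).prod (gaussianReal 0 1)).real S =
      volume.real (T ∩ Ioo (-Real.pi) Real.pi) / (2 * Real.pi) := by
  have key := fun S hS T hT hST => (gaussianReal_prod_apply_eq_lintegral S hS).trans
    (lintegral_mul_indicator_angle
      (fun q => ENNReal.ofReal ((2 * Real.pi)⁻¹ * Real.exp (-q / 2))) (by fun_prop) T hT hST)
  -- The whole plane has measure 1, which determines the radial factor without computing it.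
  have hone := congrArg ENNReal.toReal
    (key univ MeasurableSet.univ univ MeasurableSet.univ (by simp))
  have hS' := congrArg ENNReal.toReal (key S hS T hT hST)
  rw [ENNReal.toReal_mul] at hone hS'
  rw [measure_univ, univ_inter, Real.volume_Ioo, ENNReal.toReal_ofReal (by linarith [Real.pi_pos]),
    ENNReal.toReal_one] at hone
  rw [measureReal_def, hS', eq_div_iff (by positivity), mul_right_comm]
  rw [show 2 * Real.pi = Real.pi - -Real.pi by ring] at *
  rw [← hone, one_mul, measureReal_def]

lemma cos_pos_and_cos_sub_pos_iff {t θ : ℝ} (hθ : θ ∈ Icc 0 Real.pi)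
    (ht : t ∈ Ioo (-Real.pi) Real.pi) :
    0 < Real.cos t ∧ 0 < Real.cos (t - θ) ↔ t ∈ Ioo (θ - Real.pi / 2) (Real.pi / 2) := by
  obtain ⟨h0, hπ⟩ := hθ
  obtain ⟨h1, h2⟩ := ht
  constructor
  · rintro ⟨hc, hcθ⟩
    have hlt : t < Real.pi / 2 := by
      by_contra! h
      exact hc.not_ge (Real.cos_nonpos_of_pi_div_two_le_of_le h (by linarith))
    have hgt : -(Real.pi / 2) < t := by
      by_contra! h
      rw [← Real.cos_neg] at hc
      exact hc.not_ge (Real.cos_nonpos_of_pi_div_two_le_of_le (by linarith) (by linarith))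
    refine ⟨?_, hlt⟩
    by_contra! h
    rw [← Real.cos_neg] at hcθ
    exact hcθ.not_ge (Real.cos_nonpos_of_pi_div_two_le_of_le (by linarith) (by linarith))
  · rintro ⟨h3, h4⟩
    exact ⟨Real.cos_pos_of_mem_Ioo ⟨by linarith, h4⟩,
      Real.cos_pos_of_mem_Ioo ⟨by linarith, by linarith⟩⟩

/-- With `α = cos θ` the second condition becomes `cos (t - θ) > 0`, so the cone is a sector of
opening `π - θ`. -/
lemma gaussianReal_prod_quadrant {α : ℝ} (h1 : -1 ≤ α) (h2 : α ≤ 1) :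
    ((gaussianReal 0 1).prod (gaussianReal 0 1)).real
      {z | 0 < z.1 ∧ 0 < α * z.1 + √(1 - α ^ 2) * z.2} =
      (Real.pi - Real.arccos α) / (2 * Real.pi) := by
  set θ := Real.arccos α with hθ
  have hmem : θ ∈ Icc 0 Real.pi := ⟨Real.arccos_nonneg α, Real.arccos_le_pi α⟩
  have hS : MeasurableSet {z : ℝ × ℝ | 0 < z.1 ∧ 0 < α * z.1 + √(1 - α ^ 2) * z.2} :=
    (measurableSet_lt measurable_const measurable_fst).inter
      (measurableSet_lt measurable_const
        ((measurable_fst.const_mul α).add (measurable_snd.const_mul _)))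
  rw [gaussianReal_prod_cone hS (Ioo (θ - Real.pi / 2) (Real.pi / 2)) measurableSet_Ioo]
  · rw [inter_eq_left.2 (Ioo_subset_Ioo (by linarith [hmem.1, Real.pi_pos])
      (by linarith [Real.pi_pos])), Real.volume_real_Ioo_of_le (by linarith [hmem.2])]
    ring
  · intro r hr t ht
    rw [← cos_pos_and_cos_sub_pos_iff hmem ht, Real.cos_sub, hθ, Real.cos_arccos h1 h2,
      Real.sin_arccos, mem_ofPred_eq, mul_pos_iff_of_pos_left hr,
      show α * (r * Real.cos t) + √(1 - α ^ 2) * (r * Real.sin t) =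
        r * (Real.cos t * α + Real.sin t * √(1 - α ^ 2)) by ring, mul_pos_iff_of_pos_left hr]

section

variable {E : Type*} [NormedAddCommGroup E] [InnerProductSpace ℝ E] [FiniteDimensional ℝ E]
  [MeasurableSpace E] [BorelSpace E]

lemma charFunDual_gaussianReal_zero_one (L : StrongDual ℝ ℝ) :
    charFunDual (gaussianReal 0 1) L = Complex.exp (-(L 1) ^ 2 / 2) := by
  have h : charFunDual (gaussianReal 0 1) L = charFun (gaussianReal 0 1) (L 1) := by
    rw [charFunDual_apply, charFun_apply_real]
    congr with x
    have : L x = L 1 * x := by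
      simpa [mul_comm] using L.map_smul x 1
    simp [this]
  rw [h, charFun_gaussianReal]
  simp [neg_div]

/-- Both are centered Gaussian pairs with unit variances and covariance `⟪u, v⟫`, hence have the
same characteristic function. -/
lemma stdGaussian_map_inner_prod_inner {u v : E} (hu : ‖u‖ = 1) (hv : ‖v‖ = 1) :
    (stdGaussian E).map (fun x => (⟪u, x⟫, ⟪v, x⟫)) =
      ((gaussianReal 0 1).prod (gaussianReal 0 1)).map
        (fun z => (z.1, ⟪u, v⟫ * z.1 + √(1 - ⟪u, v⟫ ^ 2) * z.2)) := by
  set α := ⟪u, v⟫ with hα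
  have habs : |α| ≤ 1 := by simpa [hu, hv] using abs_real_inner_le_norm u v
  have hsqrt : √(1 - α ^ 2) ^ 2 = 1 - α ^ 2 :=
    Real.sq_sqrt (by linarith [(sq_le_one_iff_abs_le_one α).2 habs])
  set β := √(1 - α ^ 2)
  let L₁ : E →L[ℝ] ℝ × ℝ := (innerSL ℝ u).prod (innerSL ℝ v)
  let L₂ : ℝ × ℝ →L[ℝ] ℝ × ℝ := (ContinuousLinearMap.fst ℝ ℝ ℝ).prod
    (α • ContinuousLinearMap.fst ℝ ℝ ℝ + β • ContinuousLinearMap.snd ℝ ℝ ℝ)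
  change (stdGaussian E).map L₁ = ((gaussianReal 0 1).prod (gaussianReal 0 1)).map L₂
  have := Measure.isProbabilityMeasure_map (μ := stdGaussian E) L₁.continuous.aemeasurable
  have := Measure.isProbabilityMeasure_map (μ := (gaussianReal 0 1).prod (gaussianReal 0 1))
    L₂.continuous.aemeasurable
  refine Measure.ext_of_charFunDual (funext fun L => ?_)
  have hL (x y : ℝ) : L (x, y) = x * L (1, 0) + y * L (0, 1) := by
    rw [← smul_eq_mul, ← smul_eq_mul, ← map_smul, ← map_smul, ← map_add]
    simp
  have hcomp : L ∘SL L₁ = innerSL ℝ (L (1, 0) • u + L (0, 1) • v) := by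
    ext x
    simp [L₁, hL ⟪u, x⟫, mul_comm]
  have hnorm : ‖L (1, 0) • u + L (0, 1) • v‖ ^ 2 =
      L (1, 0) ^ 2 + 2 * α * L (1, 0) * L (0, 1) + L (0, 1) ^ 2 := by
    rw [norm_add_sq_real, norm_smul, norm_smul, hu, hv, real_inner_smul_left,
      real_inner_smul_right, ← hα]
    simp
    ring
  rw [charFunDual_map, charFunDual_map, charFunDual_prod, charFunDual_stdGaussian, hcomp,
    innerSL_apply_norm, charFunDual_gaussianReal_zero_one, charFunDual_gaussianReal_zero_one,
    ← Complex.exp_add]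
  congr 1
  have e1 : L (L₂ (1, 0)) = L (1, 0) + α * L (0, 1) := by simp [L₂, hL 1 α]
  have e2 : L (L₂ (0, 1)) = β * L (0, 1) := by simp [L₂, hL 0 β]
  simp only [ContinuousLinearMap.comp_apply, ContinuousLinearMap.inl_apply,
    ContinuousLinearMap.inr_apply, e1, e2]
  norm_cast
  rw [hnorm]
  linear_combination (-(L (0, 1)) ^ 2 / 2) * (-hsqrt)

/-- **Sheppard's formula**. -/
theorem stdGaussian_inner_pos_inner_pos {u v : E} (hu : ‖u‖ = 1) (hv : ‖v‖ = 1) :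
    (stdGaussian E).real {x | 0 < ⟪u, x⟫ ∧ 0 < ⟪v, x⟫} =
      (Real.pi - Real.arccos ⟪u, v⟫) / (2 * Real.pi) := by
  have habs : |⟪u, v⟫| ≤ 1 := by simpa [hu, hv] using abs_real_inner_le_norm u v
  rw [abs_le] at habs
  rw [← gaussianReal_prod_quadrant habs.1 habs.2]
  have hQ : MeasurableSet {z : ℝ × ℝ | 0 < z.1 ∧ 0 < z.2} :=
    (measurableSet_lt measurable_const measurable_fst).inter
      (measurableSet_lt measurable_const measurable_snd)
  have h := congrArg (fun μ => μ.real {z : ℝ × ℝ | 0 < z.1 ∧ 0 < z.2})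
    (stdGaussian_map_inner_prod_inner hu hv)
  rw [map_measureReal_apply (by fun_prop) hQ, map_measureReal_apply (by fun_prop) hQ] at h
  exact h

end

/-! ### Unit vectors realizing the normalized matrix -/

/-- Padding vectors of norm at most one to unit vectors without changing the mutual inner products. -/
lemma exists_unit_vectors_inner_eq {A B ι : Type*} [Fintype ι] (u : A → EuclideanSpace ℝ ι)
    (v : B → EuclideanSpace ℝ ι) (hu : ∀ a, ‖u a‖ ≤ 1) (hv : ∀ b, ‖v b‖ ≤ 1) :
    ∃ (u' : A → EuclideanSpace ℝ (ι ⊕ Fin 2)) (v' : B → EuclideanSpace ℝ (ι ⊕ Fin 2)),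
      (∀ a, ‖u' a‖ = 1) ∧ (∀ b, ‖v' b‖ = 1) ∧ ∀ a b, ⟪u' a, v' b⟫ = ⟪u a, v b⟫ := by
  have hnorm {w : EuclideanSpace ℝ ι} (hw : ‖w‖ ≤ 1) :
      ∑ i, w i ^ 2 + √(1 - ‖w‖ ^ 2) ^ 2 = 1 := by
    rw [Real.sq_sqrt (by nlinarith [norm_nonneg w]), EuclideanSpace.real_norm_sq_eq]
    ring
  -- The two families use different extra coordinates, so the padding adds nothing to mixed inner
  -- products.
  refine ⟨fun a => WithLp.toLp 2 (Sum.elim (u a) ![√(1 - ‖u a‖ ^ 2), 0]),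
    fun b => WithLp.toLp 2 (Sum.elim (v b) ![0, √(1 - ‖v b‖ ^ 2)]),
    fun a => ?_, fun b => ?_, fun a b => ?_⟩
  · rw [← sq_eq_sq₀ (norm_nonneg _) zero_le_one, EuclideanSpace.real_norm_sq_eq, one_pow]
    simpa using hnorm (hu a)
  · rw [← sq_eq_sq₀ (norm_nonneg _) zero_le_one, EuclideanSpace.real_norm_sq_eq, one_pow]
    simpa using hnorm (hv b)
  · simp [PiLp.inner_apply]

open Classical in
lemma exists_unit_vectors_inner_eq_div {A B : Type*} [Fintype A] [Fintype B] {Δ : ℝ} (hΔ : 0 ≤ Δ)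
    (M : Matrix A B ℝ) (hM : ∀ a b, |M a b| ≤ Δ) :
    ∃ (n : ℕ) (u : A → EuclideanSpace ℝ (Fin n ⊕ Fin 2)) (v : B → EuclideanSpace ℝ (Fin n ⊕ Fin 2)),
      (∀ a, ‖u a‖ = 1) ∧ (∀ b, ‖v b‖ = 1) ∧ ∀ a b, ⟪u a, v b⟫ = M a b / (Δ * √M.rank) := by
  obtain ⟨u, v, huv, hu, hv⟩ := M.exists_inner_eq_of_abs_le hM
  -- If `Δ` or the rank is 0, the inverse is 0 and so is the quotient, so no case split is needed.
  obtain ⟨u', v', hu', hv', huv'⟩ := exists_unit_vectors_inner_eq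
    (fun a => (√M.rank)⁻¹ • u a) (fun b => Δ⁻¹ • v b)
    (fun a => by
      rw [norm_smul, norm_inv, Real.norm_of_nonneg (Real.sqrt_nonneg _)]
      exact inv_mul_le_one_of_le₀ (Real.le_sqrt_of_sq_le (hu a)) (Real.sqrt_nonneg _))
    (fun b => by
      rw [norm_smul, norm_inv, Real.norm_of_nonneg hΔ]
      exact inv_mul_le_one_of_le₀ (le_of_sq_le_sq (hv b) hΔ) hΔ)
  refine ⟨M.rank, u', v', hu', hv', fun a b => ?_⟩
  rw [huv', real_inner_smul_left, real_inner_smul_right, huv, div_eq_mul_inv, mul_inv]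
  ring

/-! ### Random rectangles -/

lemma exists_pmf_rectangle_of_measurable {Ω A B : Type*} [MeasurableSpace Ω] [Finite A] [Finite B]
    (μ : Measure Ω) [IsProbabilityMeasure μ] (S : A → Set Ω) (T : B → Set Ω)
    (hS : ∀ a, MeasurableSet (S a)) (hT : ∀ b, MeasurableSet (T b)) :
    ∃ D : PMF (Rectangle A B), ∀ a b,
      D.toOuterMeasure {R | (a, b) ∈ R} = μ (S a ∩ T b) := by
  let f : Ω → Set A × Set B := fun x => ({a | x ∈ S a}, {b | x ∈ T b})
  have hf : Measurable f :=
    (measurable_set_iff.2 fun a => measurable_mem.2 (hS a)).prodMk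
      (measurable_set_iff.2 fun b => measurable_mem.2 (hT b))
  have := Measure.isProbabilityMeasure_map (μ := μ) hf.aemeasurable
  refine ⟨(μ.map f).toPMF.map fun s => ⟨s.1, s.2⟩, fun a b => ?_⟩
  rw [PMF.toOuterMeasure_map_apply,
    ← PMF.toMeasure_apply_eq_toOuterMeasure_apply _ (Set.toFinite _).measurableSet,
    Measure.toPMF_toMeasure, Measure.map_apply hf (Set.toFinite _).measurableSet]
  rfl

/-- The rectangle of entries lying in both rectangles. -/
def Rectangle.inter {A B : Type*} (R R' : Rectangle A B) : Rectangle A B :=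
  ⟨R.rows ∩ R'.rows, R.cols ∩ R'.cols⟩

lemma Rectangle.mem_inter {A B : Type*} {R R' : Rectangle A B} {p : A × B} :
    p ∈ R.inter R' ↔ p ∈ R ∧ p ∈ R' :=
  and_and_and_comm

/-- The two rectangles are drawn independently, and `p` must lie in both. -/
lemma PMF.toOuterMeasure_bind_map_inter {A B : Type*} (D D' : PMF (Rectangle A B)) (p : A × B) :
    (D.bind fun R => D'.map R.inter).toOuterMeasure {R | p ∈ R} =
      D.toOuterMeasure {R | p ∈ R} * D'.toOuterMeasure {R | p ∈ R} := by
  rw [PMF.toOuterMeasure_bind_apply, PMF.toOuterMeasure_apply D, ← ENNReal.tsum_mul_right]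
  refine tsum_congr fun R => ?_
  rw [PMF.toOuterMeasure_map_apply]
  by_cases h : p ∈ R <;> simp [Set.indicator, Set.preimage, Rectangle.mem_inter, h]

lemma PMF.exists_rectangle_pow {A B : Type*} (D : PMF (Rectangle A B)) (k : ℕ) :
    ∃ D' : PMF (Rectangle A B), ∀ p : A × B,
      D'.toOuterMeasure {R | p ∈ R} = D.toOuterMeasure {R | p ∈ R} ^ k := by
  induction k with
  | zero =>
    refine ⟨PMF.pure ⟨Set.univ, Set.univ⟩, fun p => ?_⟩
    rw [PMF.toOuterMeasure_pure_apply, if_pos ⟨Set.mem_univ _, Set.mem_univ _⟩, pow_zero]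
  | succ k ih =>
    obtain ⟨D', hD'⟩ := ih
    exact ⟨D'.bind fun R => D.map R.inter, fun p => by
      rw [PMF.toOuterMeasure_bind_map_inter, hD', pow_succ]⟩

theorem mainTheorem6 {A B : Type*} [Fintype A] [Fintype B] (Δ r : ℕ) (M : Matrix A B ℕ)
    (hM : ∀ a b, M a b ≤ Δ) (hr : (M.map (fun m : ℕ => (m : ℝ))).rank = r) (k : ℕ) :
    ∃ D : PMF (Rectangle A B), ∀ (a : A) (b : B),
      (D.toOuterMeasure {R : Rectangle A B | (a, b) ∈ R}).toReal =
        sheppardH ((M a b : ℝ) / ((Δ : ℝ) * Real.sqrt (r : ℝ))) ^ k := by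
  obtain ⟨n, u, v, hu, hv, huv⟩ := exists_unit_vectors_inner_eq_div (Nat.cast_nonneg Δ)
    (M.map (fun m : ℕ => (m : ℝ))) (fun a b => by simpa using hM a b)
  obtain ⟨D, hD⟩ := exists_pmf_rectangle_of_measurable
    (stdGaussian (EuclideanSpace ℝ (Fin n ⊕ Fin 2))) (fun a => {x | 0 < ⟪u a, x⟫})
    (fun b => {x | 0 < ⟪v b, x⟫}) (fun a => measurableSet_lt measurable_const (by fun_prop))
    (fun b => measurableSet_lt measurable_const (by fun_prop))
  obtain ⟨D', hD'⟩ := D.exists_rectangle_pow k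
  refine ⟨D', fun a b => ?_⟩
  rw [hD', ENNReal.toReal_pow, hD]
  congr 1
  refine (stdGaussian_inner_pos_inner_pos (hu a) (hv b)).trans ?_
  rw [huv, hr, Matrix.map_apply, sheppardH]
  field_simp
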